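/- Let $(Q_r)_{r\ge1}$ be positive real numbers such that $\phi_c:=\lim_{r\to\infty}Q_r^{-1/r}$ exists, is finite and satisfies $\phi_c>1$. For $V>0$ and an integer $M\ge0$ let $\pi^{V,M}$ be the probability measure on the families $\eta=(\eta_r)_{r\ge1}$ of nonnegative integers with $\sum_{r\ge1}r\eta_r=M$ given by $$\pi^{V,M}(\eta)=\frac1{Z_{V,M}}\prod_{r\ge1}\frac{(VQ_r)^{\eta_r}}{\eta_r!},$$ where $Z_{V,M}$ is the normalizing constant. For $\rho>0$ let $\varphi(\rho)$ be the unique $z\in[0,\phi_c]$ with $\sum_{r\ge1}rQ_rz^r=\min\{\rho,\rho_c\}$, where $\rho_c:=\sum_{r\ge1}rQ_r\phi_c^r\in(0,\infty]$, and let $c^\rho_r:=Q_r\varphi(\rho)^r$. For $\ell\in\mathbb R_+^\infty$ put $$H(\ell|c^\rho):=\sum_{r\ge1}\Big(\ell_r\log\frac{\ell_r}{c^\rho_r}-\ell_r+c^\rho_r\Big)\in[0,\infty],\qquad 0\log0:=0.$$ **Theorem.** Let $\rho\in(0,\infty)$, and let $V\to\infty$ along a sequence of positive reals with integers $M=M(V)\ge0$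 such that $M/V\to\rho$. Then the laws of $(\eta_r/V)_{r\ge1}$ under $\pi^{V,M}$ satisfy a large deviation principle on $\mathbb R_+^\infty=[0,\infty)^{\{1,2,\dots\}}$, with the product topology, with speed $V$ and good rate function (lower semicontinuous, $[0,\infty]$-valued, with compact level sets) $$I_\rho(\ell)=\begin{cases}H(\ell|c^\rho)-\Big(\rho-\sum_{r\ge1}r\ell_r\Big)\log\dfrac{\varphi(\rho)}{\phi_c}&\text{if }\sum_{r\ge1}r\ell_r\le\rho,\\[1ex]+\infty&\text{otherwise.}\end{cases}$$ That is, $\limsup\frac1V\log\pi^{V,M}\big((\eta_r/V)_r\in F\big)\le-\inf_FI_\rho$ for every closed $F$, and $\liminf\frac1V\log\pi^{V,M}\big((\eta_r/V)_r\in G\big)\ge-\inf_GI_\rho$ for every open $G$. -/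

import Mathlib

open Filter Topology MeasureTheory
open scoped ENNReal NNReal

namespace ClusterLDP

/-! ### The equilibrium measure -/

/-- Total mass `∑ r η_r` of a family of cluster counts: `η r` is the number of clusters of size
`r`. -/
def mass (η : ℕ+ →₀ ℕ) : ℕ := η.sum fun r k => (r : ℕ) * k

theorem finite_mass_eq (M : ℕ) : {η : ℕ+ →₀ ℕ | mass η = M}.Finite := by
  classical
  let s : Finset ℕ+ := (Finset.range M).image Nat.succPNat
  let g : ℕ+ →₀ ℕ := Finsupp.indicator s fun _ _ => M
  refine (Set.finite_Iic g).subset ?_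
  intro η hη
  have hη' : ∑ r ∈ η.support, (r : ℕ) * η r = M := hη
  intro r
  by_cases h0 : η r = 0
  · simp [h0]
  · have hr : (r : ℕ) * η r ≤ M := by
      rw [← hη']
      exact Finset.single_le_sum (f := fun r : ℕ+ => (r : ℕ) * η r)
        (fun _ _ => Nat.zero_le _) (Finsupp.mem_support_iff.2 h0)
    have h1 : (r : ℕ) ≤ M := le_trans (Nat.le_mul_of_pos_right _ (Nat.pos_of_ne_zero h0)) hr
    have h2 : η r ≤ M := le_trans (Nat.le_mul_of_pos_left _ r.pos) hr
    have hs : r ∈ s := by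
      refine Finset.mem_image.2 ⟨r.natPred, Finset.mem_range.2 ?_, PNat.succPNat_natPred r⟩
      have := PNat.natPred_add_one r
      omega
    simpa [g, Finsupp.indicator, hs] using h2

/-- The state space: cluster counts with total mass `M`. -/
noncomputable def states (M : ℕ) : Finset (ℕ+ →₀ ℕ) := (finite_mass_eq M).toFinset

theorem mem_states {M : ℕ} {η : ℕ+ →₀ ℕ} : η ∈ states M ↔ mass η = M := by
  simp [states]

/-- The Gibbs weight `∏_r (V Q_r) ^ η_r / η_r !`. -/
noncomputable def weight (Q : ℕ+ → ℝ) (V : ℝ) (η : ℕ+ →₀ ℕ) : ℝ :=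
  η.prod fun r k => (V * Q r) ^ k / (k.factorial : ℝ)

/-- The normalizing constant of the Gibbs weights on states of total mass `M`. -/
noncomputable def partitionFunction (Q : ℕ+ → ℝ) (V : ℝ) (M : ℕ) : ℝ :=
  ∑ η ∈ states M, weight Q V η

/-- The probability `π^{V,M}(η)` of a state `η` of total mass `M`. -/
noncomputable def equilibrium (Q : ℕ+ → ℝ) (V : ℝ) (M : ℕ) (η : ℕ+ →₀ ℕ) : ℝ :=
  weight Q V η / partitionFunction Q V M

/-- The scaled cluster counts `(η_r / V)_{r ≥ 1}`, a point of `ℝ_+^∞`. -/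
noncomputable def scaledCounts (V : ℝ) (η : ℕ+ →₀ ℕ) : ℕ+ → ℝ≥0 :=
  fun r => Real.toNNReal ((η r : ℝ) / V)

/-- The law of the scaled cluster counts `(η_r / V)_{r ≥ 1}` when `η` has law `π^{V,M}`. -/
noncomputable def scaledLaw (Q : ℕ+ → ℝ) (V : ℝ) (M : ℕ) : Measure (ℕ+ → ℝ≥0) :=
  ∑ η ∈ states M, ENNReal.ofReal (equilibrium Q V M η) • Measure.dirac (scaledCounts V η)

theorem weight_pos {Q : ℕ+ → ℝ} (hQ : ∀ r, 0 < Q r) {V : ℝ} (hV : 0 < V) (η : ℕ+ →₀ ℕ) :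
    0 < weight Q V η :=
  Finset.prod_pos fun r _ =>
    div_pos (pow_pos (mul_pos hV (hQ r)) _) (by exact_mod_cast Nat.factorial_pos _)

theorem partitionFunction_pos {Q : ℕ+ → ℝ} (hQ : ∀ r, 0 < Q r) {V : ℝ} (hV : 0 < V) (M : ℕ) :
    0 < partitionFunction Q V M :=
  Finset.sum_pos (fun η _ => weight_pos hQ hV η)
    ⟨Finsupp.single 1 M, mem_states.2 (by simp [mass])⟩

theorem isProbabilityMeasure_scaledLaw {Q : ℕ+ → ℝ} (hQ : ∀ r, 0 < Q r) {V : ℝ} (hV : 0 < V)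
    (M : ℕ) : IsProbabilityMeasure (scaledLaw Q V M) := by
  constructor
  have hZ := partitionFunction_pos hQ hV M
  simp only [scaledLaw, Measure.coe_finsetSum, Finset.sum_apply, Measure.smul_apply,
    measure_univ, smul_eq_mul, mul_one]
  simp only [equilibrium]
  rw [← ENNReal.ofReal_sum_of_nonneg fun η _ => (div_pos (weight_pos hQ hV η) hZ).le]
  rw [← Finset.sum_div, ← partitionFunction, div_self hZ.ne', ENNReal.ofReal_one]

/-! ### The fugacity -/

/-- The series `∑_r r Q_r z ^ r`, for `z ≥ 0`, with values in `[0, ∞]`. -/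
noncomputable def massSeries (Q : ℕ+ → ℝ) (z : ℝ) : ℝ≥0∞ :=
  ∑' r : ℕ+, ENNReal.ofReal ((r : ℝ) * Q r * z ^ (r : ℕ))

/-- The fugacity `φ(ρ)`: the largest `z ∈ [0, φ_c]` with `∑_r r Q_r z ^ r ≤ ρ`. It solves
`∑_r r Q_r φ(ρ) ^ r = ρ` if `ρ ≤ ρ_c := ∑_r r Q_r φ_c ^ r`, and `φ(ρ) = φ_c` if `ρ > ρ_c`;
see `fugacity_spec` and `fugacity_unique`. -/
noncomputable def fugacity (Q : ℕ+ → ℝ) (φc ρ : ℝ) : ℝ :=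
  sSup {z : ℝ | 0 ≤ z ∧ z ≤ φc ∧ massSeries Q z ≤ ENNReal.ofReal ρ}

theorem summable_mass {Q : ℕ+ → ℝ} (hQ : ∀ r, 0 < Q r) {φc : ℝ}
    (hφc : Tendsto (fun r : ℕ+ => Q r ^ (-(1 : ℝ) / (r : ℝ))) atTop (𝓝 φc))
    {z : ℝ} (hz : 0 ≤ z) (hzc : z < φc) :
    Summable fun r : ℕ+ => (r : ℝ) * Q r * z ^ (r : ℕ) := by
  obtain ⟨b, hzb, hbc⟩ := exists_between hzc
  have hb : 0 < b := hz.trans_lt hzb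
  have hgeo : Summable fun r : ℕ+ => ((r : ℕ) : ℝ) * (z / b) ^ (r : ℕ) := by
    have h := summable_pow_mul_geometric_of_norm_lt_one (R := ℝ) 1 (r := z / b)
      (by rw [Real.norm_of_nonneg (by positivity), div_lt_one hb]; exact hzb)
    simp only [pow_one] at h
    exact h.comp_injective PNat.coe_injective
  refine hgeo.of_norm_bounded_eventually ?_
  obtain ⟨N, hN⟩ := eventually_atTop.1 (hφc.eventually (lt_mem_nhds hbc))
  rw [Filter.eventually_cofinite]
  refine (Set.finite_Iio N).subset fun r hr => ?_
  by_contra hrN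
  apply hr
  have hr' := hN r (not_lt.1 hrN)
  have hr0 : (0 : ℝ) < (r : ℕ) := by exact_mod_cast r.pos
  have hkey : b ^ (r : ℕ) ≤ (Q r)⁻¹ := by
    have h1 : b ^ (r : ℕ) ≤ (Q r ^ (-(1 : ℝ) / (r : ℝ))) ^ (r : ℕ) :=
      pow_le_pow_left₀ hb.le hr'.le _
    rwa [← Real.rpow_natCast (Q r ^ (-(1 : ℝ) / (r : ℝ))), ← Real.rpow_mul (hQ r).le,
      div_mul_cancel₀ _ hr0.ne', Real.rpow_neg_one] at h1
  have hQb : Q r ≤ (b ^ (r : ℕ))⁻¹ := by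
    have := inv_anti₀ (pow_pos hb _) hkey
    rwa [inv_inv] at this
  rw [Real.norm_of_nonneg (by have := (hQ r).le; positivity), div_pow, div_eq_mul_inv, mul_assoc,
    mul_comm (Q r)]
  gcongr

theorem fugacity_spec {Q : ℕ+ → ℝ} (hQ : ∀ r, 0 < Q r) {φc : ℝ} (hc : 0 < φc)
    (hφc : Tendsto (fun r : ℕ+ => Q r ^ (-(1 : ℝ) / (r : ℝ))) atTop (𝓝 φc)) (ρ : ℝ) :
    0 ≤ fugacity Q φc ρ ∧ fugacity Q φc ρ ≤ φc ∧
      massSeries Q (fugacity Q φc ρ) = min (ENNReal.ofReal ρ) (massSeries Q φc) := by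
  set S : Set ℝ := {z : ℝ | 0 ≤ z ∧ z ≤ φc ∧ massSeries Q z ≤ ENNReal.ofReal ρ} with hS
  have hlsc : LowerSemicontinuous (massSeries Q) := by
    refine lowerSemicontinuous_tsum fun r => Continuous.lowerSemicontinuous ?_
    exact ENNReal.continuous_ofReal.comp (by fun_prop)
  have hclosed : IsClosed S := by
    have : S = Set.Icc 0 φc ∩ massSeries Q ⁻¹' Set.Iic (ENNReal.ofReal ρ) := by
      ext z; simp [hS, and_assoc]
    rw [this]
    exact isClosed_Icc.inter (hlsc.isClosed_preimage _)
  have hne : S.Nonempty := ⟨0, le_rfl, hc.le, by simp [massSeries]⟩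
  have hbdd : BddAbove S := ⟨φc, fun z hz => hz.2.1⟩
  have hmem : fugacity Q φc ρ ∈ S := hclosed.csSup_mem hne hbdd
  have hmax : ∀ z ∈ S, z ≤ fugacity Q φc ρ := fun z hz => le_csSup hbdd hz
  set f := fugacity Q φc ρ with hf
  obtain ⟨h0, h1, h2⟩ := hmem
  have hmono : ∀ x y : ℝ, 0 ≤ x → x ≤ y → massSeries Q x ≤ massSeries Q y := by
    intro x y hx hxy
    refine ENNReal.tsum_le_tsum fun r => ENNReal.ofReal_le_ofReal ?_
    have := (hQ r).le
    gcongr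
  refine ⟨h0, h1, le_antisymm (le_min h2 (hmono _ _ h0 h1)) ?_⟩
  rcases h1.eq_or_lt with h | h
  · rw [h]; exact min_le_right _ _
  · refine (min_le_left _ _).trans ?_
    obtain ⟨z₁, hz₁, hz₁c⟩ := exists_between h
    have hsum := summable_mass hQ hφc (h0.trans hz₁.le) hz₁c
    have hcont : ContinuousOn (fun z : ℝ => ∑' r : ℕ+, (r : ℝ) * Q r * z ^ (r : ℕ))
        (Set.Icc 0 z₁) := by
      refine continuousOn_tsum (fun r => by fun_prop) hsum fun r z hz => ?_
      have hq := (hQ r).le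
      have hz0 := hz.1
      rw [Real.norm_of_nonneg (by positivity)]
      gcongr
      exact hz.2
    have heq : ∀ z ∈ Set.Icc 0 z₁, massSeries Q z =
        ENNReal.ofReal (∑' r : ℕ+, (r : ℝ) * Q r * z ^ (r : ℕ)) := by
      intro z hz
      have hz0 := hz.1
      refine (ENNReal.ofReal_tsum_of_nonneg (fun r => ?_)
        (summable_mass hQ hφc hz0 (hz.2.trans_lt hz₁c))).symm
      have hq := (hQ r).le
      positivity
    have hcont' : ContinuousOn (massSeries Q) (Set.Icc 0 z₁) :=
      (ENNReal.continuous_ofReal.comp_continuousOn hcont).congr heq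
    have hlim : Tendsto (massSeries Q) (𝓝[Set.Ioc f z₁] f) (𝓝 (massSeries Q f)) :=
      (hcont' f ⟨h0, hz₁.le⟩).mono_left
        (nhdsWithin_mono _ fun z hz => ⟨h0.trans hz.1.le, hz.2⟩)
    have : (𝓝[Set.Ioc f z₁] f).NeBot := by
      rw [nhdsWithin_Ioc_eq_nhdsGT hz₁]; infer_instance
    refine ge_of_tendsto hlim (eventually_nhdsWithin_of_forall fun z hz => ?_)
    by_contra hlt
    exact absurd (hmax z ⟨h0.trans hz.1.le, hz.2.trans hz₁c.le, (not_le.1 hlt).le⟩)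
      (not_le.2 hz.1)

theorem fugacity_unique {Q : ℕ+ → ℝ} (hQ : ∀ r, 0 < Q r) {φc : ℝ} (hc : 0 < φc)
    (hφc : Tendsto (fun r : ℕ+ => Q r ^ (-(1 : ℝ) / (r : ℝ))) atTop (𝓝 φc)) (ρ : ℝ)
    {z : ℝ} (hz : 0 ≤ z) (hz' : massSeries Q z = min (ENNReal.ofReal ρ) (massSeries Q φc)) :
    z = fugacity Q φc ρ := by
  have hstrict : ∀ x y : ℝ, 0 ≤ x → x < y → massSeries Q x ≠ ∞ →
      massSeries Q x < massSeries Q y := by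
    intro x y hx hxy hfin
    refine ENNReal.tsum_lt_tsum (i := 1) hfin (fun r => ENNReal.ofReal_le_ofReal ?_) ?_
    · have := (hQ r).le
      gcongr
    · have := hQ 1
      rw [ENNReal.ofReal_lt_ofReal_iff (by have := hx.trans_lt hxy; simp; positivity)]
      simpa using mul_lt_mul_of_pos_left hxy this
  obtain ⟨h0, -, h2⟩ := fugacity_spec hQ hc hφc ρ
  have hfin : min (ENNReal.ofReal ρ) (massSeries Q φc) ≠ ∞ :=
    ne_top_of_le_ne_top ENNReal.ofReal_ne_top (min_le_left _ _)
  rcases lt_trichotomy z (fugacity Q φc ρ) with h | h | h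
  · exact absurd (hstrict _ _ hz h (hz' ▸ hfin)) (by rw [hz', h2]; exact lt_irrefl _)
  · exact h
  · exact absurd (hstrict _ _ h0 h (h2 ▸ hfin)) (by rw [hz', h2]; exact lt_irrefl _)

/-- The equilibrium profile `c^ρ_r = Q_r φ(ρ) ^ r`. -/
noncomputable def profile (Q : ℕ+ → ℝ) (φc ρ : ℝ) (r : ℕ+) : ℝ :=
  Q r * fugacity Q φc ρ ^ (r : ℕ)

/-! ### The rate function -/

/-- The relative entropy `H(ℓ | c) = ∑_r (ℓ_r log (ℓ_r / c_r) - ℓ_r + c_r)`, with `0 log 0 = 0`,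
for `c_r > 0`. All terms are nonnegative, and the sum is taken in `[0, ∞]`. -/
noncomputable def relEntropy (ℓ : ℕ+ → ℝ≥0) (c : ℕ+ → ℝ) : ℝ≥0∞ :=
  ∑' r : ℕ+, ENNReal.ofReal ((ℓ r : ℝ) * Real.log ((ℓ r : ℝ) / c r) - (ℓ r : ℝ) + c r)

open Classical in
/-- The rate function: `H(ℓ | c^ρ) - (ρ - ∑ r ℓ_r) log (φ(ρ) / φ_c)` if `∑ r ℓ_r ≤ ρ`, and `∞`
otherwise. -/
noncomputable def rate (Q : ℕ+ → ℝ) (φc ρ : ℝ) (ℓ : ℕ+ → ℝ≥0) : EReal :=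
  if ∑' r : ℕ+, (r : ℝ≥0∞) * (ℓ r : ℝ≥0∞) ≤ ENNReal.ofReal ρ then
    (relEntropy ℓ (profile Q φc ρ) : EReal) -
      (((ρ - ∑' r : ℕ+, (r : ℝ) * (ℓ r : ℝ)) * Real.log (fugacity Q φc ρ / φc) : ℝ) : EReal)
  else ⊤

/-! ### Large deviation principles -/

/-- The measures `μ n` satisfy the large deviation principle with speed `a n` and good rate
function `I : X → [0, ∞]` (that is, `I` is lower semicontinuous with compact level sets). -/
structure IsGoodLDP {X : Type*} [TopologicalSpace X] [MeasurableSpace X]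
    (μ : ℕ → Measure X) (a : ℕ → ℝ) (I : X → EReal) : Prop where
  nonneg : ∀ x, 0 ≤ I x
  lsc : LowerSemicontinuous I
  isCompact_level : ∀ t : ℝ, IsCompact {x | I x ≤ (t : EReal)}
  upper : ∀ F : Set X, IsClosed F →
    limsup (fun n => (((a n)⁻¹ : ℝ) : EReal) * ENNReal.log (μ n F)) atTop ≤ -⨅ x ∈ F, I x
  lower : ∀ G : Set X, IsOpen G →
    -⨅ x ∈ G, I x ≤ liminf (fun n => (((a n)⁻¹ : ℝ) : EReal) * ENNReal.log (μ n G)) atTop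

end ClusterLDP

/-!
The proof compares probabilities with Gibbs sums and never needs the asymptotics of the number of
states.

Write `c` for the equilibrium profile `c^ρ` and `T = -log (φ(ρ) / φ_c) ≥ 0`. A geometric tilt
`Q_r ↦ Q_r z ^ r` multiplies all weights of states of the same mass by one constant, so `Q` may be
replaced by `c` (`scaledLaw_geometric_tilt`). It is then enough to bound, on the exponential scale,
the sum of the weights `∏ (V c_r) ^ η_r / η_r !` over the states with `η / V` in a small open set.

*Upper estimate.* Without the mass constraint the sum of all weights for activities `d` is
`exp (V ∑ d_r)` (`partitionFunction_le_exp`). Near `ℓ`, the activities `c` are compared with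
`d_r ≈ ℓ_r` for `r` in a large finite set `s` and `d_r = c_r exp (r τ)` for the other sizes, with
`τ < T`. As the total mass is fixed, the density of `c` with respect to `d` depends on the
coordinates in `s` only, and there it is the exponential of a linear function
(`gibbsSum_le_of_tilt`). As `s` grows and `τ → T`, the exponent tends to the rate at `ℓ`
(`exists_isOpen_gibbsSum_le`).

*Lower estimate.* For a finitely supported profile with `ℓ_1 > 0` and mass exactly `ρ`, the weight
of one rounded state is enough (`hasExpLowerBound_of_mass_eq`). Such lower bounds pass to limits of
profiles (`HasExpLowerBound.of_tendsto`). A mass deficit `x` is realized by `x / R` clusters of a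
size `R → ∞`; since `log (c_R) / R → -T`, their entropy tends to `x T`, the second term of the rate
function. Truncation then gives all profiles (`hasExpLowerBound`).

*Conclusion.* At `ℓ = c` the rate is `0`: either `c` has mass `ρ`, or `φ(ρ) = φ_c` and `T = 0`
(`profile_mass`). Hence the lower estimate at `c` identifies the partition function up to
`exp (o(V))`, and both estimates hold for probabilities. The states eventually lie in the compact
set of profiles of mass at most `ρ + 1`, so the local estimates give the large deviation
principle; the regularity of the rate function comes for free (`IsGoodLDP.of_local`).
-/

namespace ClusterLDP

/-! ### Large deviation principles from local estimates -/

theorem inv_mul_log_le {a b : ℝ} (ha : 0 < a) {m : ℝ≥0∞}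
    (h : m ≤ ENNReal.ofReal (Real.exp (-(a * b)))) :
    ((a⁻¹ : ℝ) : EReal) * ENNReal.log m ≤ -(b : EReal) := by
  have h1 := ENNReal.log_monotone h
  rw [ENNReal.log_ofReal_of_pos (Real.exp_pos _), Real.log_exp] at h1
  refine (mul_le_mul_of_nonneg_left h1 (by exact_mod_cast (inv_pos.2 ha).le)).trans_eq ?_
  rw [← EReal.coe_mul, ← EReal.coe_neg]
  congr 1
  field_simp

theorem le_inv_mul_log {a b : ℝ} (ha : 0 < a) {m : ℝ≥0∞}
    (h : ENNReal.ofReal (Real.exp (-(a * b))) ≤ m) :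
    -(b : EReal) ≤ ((a⁻¹ : ℝ) : EReal) * ENNReal.log m := by
  have h1 := ENNReal.log_monotone h
  rw [ENNReal.log_ofReal_of_pos (Real.exp_pos _), Real.log_exp] at h1
  refine Eq.trans_le ?_
    (mul_le_mul_of_nonneg_left h1 (by exact_mod_cast (inv_pos.2 ha).le))
  rw [← EReal.coe_mul, ← EReal.coe_neg]
  congr 1
  field_simp

/-- Local exponential estimates and a compact set that eventually carries the measures give a
large deviation principle with good rate function. Regularity of `I` need not be assumed: it
is forced by comparing the two local estimates on the same open set. -/
theorem IsGoodLDP.of_local {X : Type*} [TopologicalSpace X] [T2Space X] [MeasurableSpace X]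
    {μ : ℕ → Measure X} {a : ℕ → ℝ} {I : X → EReal} {K : Set X}
    (hμ : ∀ n, IsProbabilityMeasure (μ n)) (ha : ∀ n, 0 < a n) (ha' : Tendsto a atTop atTop)
    (hK : IsCompact K) (hμK : ∀ᶠ n in atTop, μ n Kᶜ = 0)
    (hup : ∀ x, ∀ b : ℝ, (b : EReal) < I x → ∃ U, IsOpen U ∧ x ∈ U ∧
      ∀ᶠ n in atTop, μ n U ≤ ENNReal.ofReal (Real.exp (-(a n * b))))
    (hlow : ∀ x, ∀ b : ℝ, I x < (b : EReal) → ∀ G, IsOpen G → x ∈ G →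
      ∀ᶠ n in atTop, ENNReal.ofReal (Real.exp (-(a n * b))) ≤ μ n G) :
    IsGoodLDP μ a I := by
  -- an upper estimate on any open set containing `x` bounds `I x` from below
  have hcmp : ∀ x, ∀ b : ℝ, ∀ U, IsOpen U → x ∈ U →
      (∀ᶠ n in atTop, μ n U ≤ ENNReal.ofReal (Real.exp (-(a n * b)))) → (b : EReal) ≤ I x := by
    intro x b U hU hx h
    by_contra! hlt
    obtain ⟨b', h1, h2⟩ := EReal.lt_iff_exists_real_btwn.1 hlt
    obtain ⟨n, hn, hn'⟩ := (h.and (hlow x b' h1 U hU hx)).exists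
    have h3 := hn'.trans hn
    rw [ENNReal.ofReal_le_ofReal_iff (Real.exp_pos _).le, Real.exp_le_exp] at h3
    have h4 := mul_lt_mul_of_pos_left (EReal.coe_lt_coe_iff.1 h2) (ha n)
    linarith
  have hlsc : LowerSemicontinuous I := by
    intro x y hy
    obtain ⟨b, h1, h2⟩ := EReal.lt_iff_exists_real_btwn.1 hy
    obtain ⟨U, hU, hxU, h⟩ := hup x b h2
    filter_upwards [hU.mem_nhds hxU] with z hz
    exact h1.trans_le (hcmp z b U hU hz h)
  have hsub : ∀ t : ℝ, {x | I x ≤ (t : EReal)} ⊆ K := by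
    intro t x hx
    by_contra hxK
    have hx' : I x < ((t + 1 : ℝ) : EReal) :=
      lt_of_le_of_lt hx (EReal.coe_lt_coe_iff.2 (by linarith))
    obtain ⟨n, hn, hn'⟩ :=
      ((hlow x _ hx' Kᶜ hK.isClosed.isOpen_compl hxK).and hμK).exists
    rw [hn', nonpos_iff_eq_zero, ENNReal.ofReal_eq_zero] at hn
    exact absurd hn (not_le.2 (Real.exp_pos _))
  refine ⟨fun x => ?_, hlsc, fun t => ?_, fun F hF => ?_, fun G hG => ?_⟩
  · refine hcmp x 0 Set.univ isOpen_univ trivial (Eventually.of_forall fun n => ?_)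
    have := hμ n
    simp
  · exact hK.of_isClosed_subset (hlsc.isClosed_preimage _) (hsub t)
  · rw [EReal.le_neg]
    refine EReal.ge_of_forall_gt_iff_ge.1 fun b hb => ?_
    rw [EReal.le_neg]
    obtain ⟨b', hbb', hb'⟩ := EReal.lt_iff_exists_real_btwn.1 hb
    have hcov : ∃ N : ℕ, ∀ᶠ n in atTop,
        μ n (F ∩ K) ≤ N * ENNReal.ofReal (Real.exp (-(a n * b'))) := by
      refine (hK.inter_left hF).induction_on
        (p := fun S => ∃ N : ℕ, ∀ᶠ n in atTop,
          μ n S ≤ N * ENNReal.ofReal (Real.exp (-(a n * b')))) ⟨0, by simp⟩ ?_ ?_ ?_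
      · rintro S S' hS ⟨N, hN⟩
        exact ⟨N, hN.mono fun n hn => (measure_mono hS).trans hn⟩
      · rintro S S' ⟨N, hN⟩ ⟨N', hN'⟩
        refine ⟨N + N', ?_⟩
        filter_upwards [hN, hN'] with n h1 h2
        push_cast
        rw [add_mul]
        exact (measure_union_le _ _).trans (add_le_add h1 h2)
      · intro x hx
        obtain ⟨U, hU, hxU, h⟩ := hup x b' (hb'.trans_le (iInf₂_le x hx.1))
        exact ⟨U, mem_nhdsWithin_of_mem_nhds (hU.mem_nhds hxU), 1, by simpa using h⟩
    obtain ⟨N, hN⟩ := hcov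
    -- the number `N` of covering sets is absorbed by passing from `b'` to `b < b'`
    have hd : 0 < b' - b := sub_pos.2 (EReal.coe_lt_coe_iff.1 hbb')
    have hbig : ∀ᶠ n in atTop, (N : ℝ) ≤ Real.exp (a n * (b' - b)) :=
      (Real.tendsto_exp_atTop.comp (ha'.atTop_mul_const hd)).eventually_ge_atTop _
    refine limsup_le_of_le (by isBoundedDefault) ?_
    filter_upwards [hN, hbig, hμK] with n h1 h2 h3
    refine inv_mul_log_le (ha n) ?_
    calc μ n F ≤ μ n (F ∩ K) + μ n Kᶜ :=
          (measure_mono fun x hx => by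
            by_cases hxK : x ∈ K
            · exact Or.inl ⟨hx, hxK⟩
            · exact Or.inr hxK).trans (measure_union_le _ _)
      _ ≤ N * ENNReal.ofReal (Real.exp (-(a n * b'))) := by rw [h3, add_zero]; exact h1
      _ = ENNReal.ofReal (N * Real.exp (-(a n * b'))) := by
          rw [ENNReal.ofReal_mul (Nat.cast_nonneg _), ENNReal.ofReal_natCast]
      _ ≤ ENNReal.ofReal (Real.exp (a n * (b' - b)) * Real.exp (-(a n * b'))) := by gcongr
      _ = ENNReal.ofReal (Real.exp (-(a n * b))) := by
          rw [← Real.exp_add]; congr 2; ring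
  · rw [EReal.neg_le]
    refine le_iInf₂ fun x hx => EReal.le_of_forall_lt_iff_le.1 fun b hb => ?_
    rw [EReal.neg_le]
    refine le_liminf_of_le (by isBoundedDefault) ?_
    filter_upwards [hlow x b hb G hG hx] with n hn
    exact le_inv_mul_log (ha n) hn

/-! ### Gibbs sums and tilting -/

open Classical in
/-- The total Gibbs weight of the states of mass `M` whose scaled counts lie in `A`. -/
noncomputable def gibbsSum (c : ℕ+ → ℝ) (V : ℝ) (M : ℕ) (A : Set (ℕ+ → ℝ≥0)) : ℝ :=
  ∑ η ∈ states M with scaledCounts V η ∈ A, weight c V η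

theorem scaledLaw_apply {c : ℕ+ → ℝ} (hc : ∀ r, 0 < c r) {V : ℝ} (hV : 0 < V) (M : ℕ)
    {A : Set (ℕ+ → ℝ≥0)} (hA : MeasurableSet A) :
    scaledLaw c V M A = ENNReal.ofReal (gibbsSum c V M A / partitionFunction c V M) := by
  classical
  have hZ := partitionFunction_pos hc hV M
  simp only [scaledLaw, Measure.coe_finsetSum, Finset.sum_apply, Measure.smul_apply, smul_eq_mul,
    Measure.dirac_apply' _ hA, gibbsSum, Finset.sum_div]
  rw [ENNReal.ofReal_sum_of_nonneg fun η _ => (div_pos (weight_pos hc hV η) hZ).le,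
    Finset.sum_filter]
  refine Finset.sum_congr rfl fun η _ => ?_
  by_cases h : scaledCounts V η ∈ A <;> simp [h, equilibrium]

theorem gibbsSum_univ (c : ℕ+ → ℝ) (V : ℝ) (M : ℕ) :
    gibbsSum c V M Set.univ = partitionFunction c V M := by
  simp [gibbsSum, partitionFunction]

theorem weight_tilt (c θ : ℕ+ → ℝ) (V : ℝ) (η : ℕ+ →₀ ℕ) :
    weight (fun r => c r * Real.exp (θ r)) V η
      = weight c V η * Real.exp (η.sum fun r k => k * θ r) := by
  simp only [weight, Finsupp.prod, Finsupp.sum, Real.exp_sum, ← Finset.prod_mul_distrib]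
  refine Finset.prod_congr rfl fun r _ => ?_
  rw [← mul_assoc, mul_pow, ← Real.exp_nat_mul]
  ring

theorem sum_mul_eq_mass (η : ℕ+ →₀ ℕ) (τ : ℝ) :
    (η.sum fun r k => (k : ℝ) * ((r : ℝ) * τ)) = mass η * τ := by
  simp only [mass, Finsupp.sum]
  push_cast
  rw [Finset.sum_mul]
  exact Finset.sum_congr rfl fun r _ => by ring

/-- A geometric tilt multiplies all Gibbs weights at given mass by the same factor, so it does
not change the equilibrium measure. -/
theorem scaledLaw_geometric_tilt (c : ℕ+ → ℝ) (τ V : ℝ) (M : ℕ) :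
    scaledLaw (fun r => c r * Real.exp (r * τ)) V M = scaledLaw c V M := by
  have hw : ∀ η ∈ states M, weight (fun r : ℕ+ => c r * Real.exp (r * τ)) V η
      = weight c V η * Real.exp (M * τ) := by
    intro η hη
    rw [weight_tilt, sum_mul_eq_mass, mem_states.1 hη]
  have hZ : partitionFunction (fun r : ℕ+ => c r * Real.exp (r * τ)) V M
      = partitionFunction c V M * Real.exp (M * τ) := by
    rw [partitionFunction, partitionFunction, Finset.sum_mul]
    exact Finset.sum_congr rfl hw
  unfold scaledLaw
  refine Finset.sum_congr rfl fun η hη => ?_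
  rw [equilibrium, equilibrium, hw η hη, hZ, mul_div_mul_right _ _ (Real.exp_pos _).ne']

/-- Dropping the mass constraint turns the partition function into a product of exponential
series. -/
theorem partitionFunction_le_exp {d : ℕ+ → ℝ} (hd : ∀ r, 0 < d r) (hs : Summable d)
    {V : ℝ} (hV : 0 < V) (M : ℕ) :
    partitionFunction d V M ≤ Real.exp (V * ∑' r, d r) := by
  classical
  set s : Finset ℕ+ := (states M).biUnion Finsupp.support with hsdef
  set N : ℕ := (states M).sup fun η => η.support.sup η
  have hsupp : ∀ η ∈ states M, η.support ⊆ s := fun η hη =>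
    Finset.subset_biUnion_of_mem Finsupp.support hη
  have hle : ∀ η ∈ states M, ∀ r, η r ≤ N := by
    intro η hη r
    by_cases hr : r ∈ η.support
    · exact (Finset.le_sup (f := η) hr).trans
        (Finset.le_sup (f := fun η : ℕ+ →₀ ℕ => η.support.sup η) hη)
    · simp [Finsupp.notMem_support_iff.1 hr]
  let g : ℕ+ → ℕ → ℝ := fun r k => (V * d r) ^ k / (k.factorial : ℝ)
  have hg : ∀ r k, 0 ≤ g r k := fun r k => by have := (hd r).le; positivity
  let i : (ℕ+ →₀ ℕ) → ∀ r ∈ s, ℕ := fun η r _ => η r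
  have hinj : Set.InjOn i (states M : Set (ℕ+ →₀ ℕ)) := by
    intro η hη η' hη' h
    ext r
    by_cases hr : r ∈ s
    · exact congrFun (congrFun h r) hr
    · rw [Finsupp.notMem_support_iff.1 fun h => hr (hsupp η hη h),
        Finsupp.notMem_support_iff.1 fun h => hr (hsupp η' hη' h)]
  calc partitionFunction d V M
      = ∑ η ∈ states M, ∏ x ∈ s.attach, g x.1 (i η x.1 x.2) := by
        refine Finset.sum_congr rfl fun η hη => ?_
        rw [Finset.prod_attach s fun r => g r (η r), weight,
          Finsupp.prod_of_support_subset η (hsupp η hη) g (by simp [g])]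
    _ = ∑ p ∈ (states M).image i, ∏ x ∈ s.attach, g x.1 (p x.1 x.2) := by
        rw [Finset.sum_image hinj]
    _ ≤ ∑ p ∈ s.pi fun _ => Finset.range (N + 1), ∏ x ∈ s.attach, g x.1 (p x.1 x.2) := by
        refine Finset.sum_le_sum_of_subset_of_nonneg ?_ fun p _ _ =>
          Finset.prod_nonneg fun x _ => hg _ _
        intro p hp
        obtain ⟨η, hη, rfl⟩ := Finset.mem_image.1 hp
        exact Finset.mem_pi.2 fun r _ => Finset.mem_range.2 (Nat.lt_succ_of_le (hle η hη r))
    _ = ∏ r ∈ s, ∑ k ∈ Finset.range (N + 1), g r k := (Finset.prod_sum _ _ _).symm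
    _ ≤ ∏ r ∈ s, Real.exp (V * d r) :=
        Finset.prod_le_prod (fun r _ => Finset.sum_nonneg fun k _ => hg r k) fun r _ =>
          Real.sum_le_exp_of_nonneg (mul_pos hV (hd r)).le _
    _ = Real.exp (V * ∑ r ∈ s, d r) := by rw [← Real.exp_sum, Finset.mul_sum]
    _ ≤ Real.exp (V * ∑' r, d r) := by
        gcongr
        exact hs.sum_le_tsum s fun r _ => (hd r).le

/-! ### The local upper estimate -/

theorem entropy_term_nonneg {x c : ℝ} (hx : 0 ≤ x) (hc : 0 < c) :
    0 ≤ x * Real.log (x / c) - x + c := by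
  have h := mul_nonneg hc.le (InformationTheory.klFun_nonneg (div_nonneg hx hc.le))
  rw [InformationTheory.klFun] at h
  have h2 : c * (x / c * Real.log (x / c) + 1 - x / c) = x * Real.log (x / c) - x + c := by
    field_simp
    ring
  rwa [h2] at h

theorem eventually_lt_sum_of_lt_tsum_ofReal {ι : Type*} {h : ι → ℝ} (hh : ∀ i, 0 ≤ h i) {b : ℝ}
    (hb : (b : EReal) < ((∑' i, ENNReal.ofReal (h i) : ℝ≥0∞) : EReal)) :
    ∀ᶠ s : Finset ι in atTop, b < ∑ i ∈ s, h i := by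
  have hlim := (continuous_coe_ennreal_ereal.tendsto _).comp
    (ENNReal.summable (f := fun i => ENNReal.ofReal (h i))).hasSum
  filter_upwards [hlim.eventually (lt_mem_nhds hb)] with s hs
  simp only [Function.comp_apply] at hs
  rw [← ENNReal.ofReal_sum_of_nonneg fun i _ => hh i, EReal.coe_ennreal_ofReal,
    max_eq_left (Finset.sum_nonneg fun i _ => hh i)] at hs
  exact EReal.coe_lt_coe_iff.1 hs

/-- Exponential Markov inequality: the weights `c` are compared with `c * exp θ`, where `θ` is
linear in the cluster size off the finite set `s`, so that the mass constraint turns the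
contribution of the infinitely many sizes off `s` into one of finitely many coordinates. -/
theorem gibbsSum_le_of_tilt {c θ : ℕ+ → ℝ} (hc : ∀ r, 0 < c r)
    (hd : Summable fun r => c r * Real.exp (θ r)) {s : Finset ℕ+} {τ : ℝ}
    (hθ : ∀ r, r ∉ s → θ r = r * τ) {V : ℝ} (hV : 0 < V) (M : ℕ) {U : Set (ℕ+ → ℝ≥0)} {B : ℝ}
    (hU : ∀ y ∈ U, B ≤ ∑ r ∈ s, (θ r - r * τ) * (y r : ℝ)) :
    gibbsSum c V M U
      ≤ Real.exp (V * ∑' r, c r * Real.exp (θ r)) * Real.exp (-(V * B + M * τ)) := by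
  classical
  have hd0 : ∀ r, 0 < c r * Real.exp (θ r) := fun r => mul_pos (hc r) (Real.exp_pos _)
  have hkey : ∀ η ∈ (states M).filter fun η => scaledCounts V η ∈ U,
      weight c V η ≤ weight (fun r => c r * Real.exp (θ r)) V η
        * Real.exp (-(V * B + M * τ)) := by
    intro η hη
    obtain ⟨hM, hηU⟩ := Finset.mem_filter.1 hη
    have hsplit : (η.sum fun r k => (k : ℝ) * θ r)
        = (∑ r ∈ s, η r * (θ r - r * τ)) + M * τ := by
      have h1 : (η.sum fun r k => (k : ℝ) * (θ r - r * τ))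
          = ∑ r ∈ s, η r * (θ r - r * τ) := by
        rw [Finsupp.sum_of_support_subset η (Finset.subset_union_left (s₂ := s)) _ (by simp)]
        refine (Finset.sum_subset Finset.subset_union_right fun r _ hr => ?_).symm
        simp [hθ r hr]
      rw [← h1, ← mem_states.1 hM, ← sum_mul_eq_mass, ← Finsupp.sum_add]
      exact Finset.sum_congr rfl fun r _ => by ring
    have hB : V * B ≤ ∑ r ∈ s, η r * (θ r - r * τ) := by
      refine (mul_le_mul_of_nonneg_left (hU _ hηU) hV.le).trans_eq ?_
      rw [Finset.mul_sum]
      refine Finset.sum_congr rfl fun r _ => ?_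
      rw [scaledCounts, Real.coe_toNNReal _ (by positivity)]
      field_simp
    rw [weight_tilt, mul_assoc, ← Real.exp_add, hsplit]
    refine le_mul_of_one_le_right (weight_pos hc hV η).le (Real.one_le_exp ?_)
    linarith
  calc gibbsSum c V M U
      ≤ ∑ η ∈ (states M).filter fun η => scaledCounts V η ∈ U,
          weight (fun r => c r * Real.exp (θ r)) V η * Real.exp (-(V * B + M * τ)) := by
        rw [gibbsSum]
        exact Finset.sum_le_sum hkey
    _ ≤ partitionFunction (fun r => c r * Real.exp (θ r)) V M
          * Real.exp (-(V * B + M * τ)) := by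
        rw [← Finset.sum_mul]
        gcongr
        exact Finset.sum_le_sum_of_subset_of_nonneg (Finset.filter_subset _ _)
          fun η _ _ => (weight_pos hd0 hV η).le
    _ ≤ _ := by
        gcongr
        exact partitionFunction_le_exp hd0 hd hV M

/-- The tilt is optimal at `ℓ`: it moves `c` to `ℓ` on a large finite set `s` of sizes (to
`ℓ + δ`, as `ℓ` may vanish) and to `c_r exp (r τ)` off `s`, with `τ` close to `T`. -/
theorem exists_isOpen_gibbsSum_le {c : ℕ+ → ℝ} (hc : ∀ r, 0 < c r) (hcs : Summable c) {T : ℝ}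
    (hT : ∀ τ < T, Summable fun r : ℕ+ => c r * Real.exp (r * τ)) {ρ : ℝ}
    {V : ℕ → ℝ} (hVpos : ∀ n, 0 < V n) {M : ℕ → ℕ}
    (hM : Tendsto (fun n => (M n : ℝ) / V n) atTop (𝓝 ρ)) {ℓ : ℕ+ → ℝ≥0}
    (hℓ : Summable fun r : ℕ+ => (r : ℝ) * (ℓ r : ℝ)) (hx : ∑' r : ℕ+, (r : ℝ) * (ℓ r : ℝ) ≤ ρ)
    {b : ℝ}
    (hb : ((b - (ρ - ∑' r : ℕ+, (r : ℝ) * (ℓ r : ℝ)) * T : ℝ) : EReal) < relEntropy ℓ c) :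
    ∃ U, IsOpen U ∧ ℓ ∈ U ∧
      ∀ᶠ n in atTop, gibbsSum c (V n) (M n) U ≤ Real.exp (V n * (∑' r, c r - b)) := by
  classical
  set x := ρ - ∑' r : ℕ+, (r : ℝ) * (ℓ r : ℝ) with hxdef
  have hx0 : 0 ≤ x := sub_nonneg.2 hx
  obtain ⟨b₁, hbb₁, hb₁⟩ := EReal.lt_iff_exists_real_btwn.1 hb
  set ε := (b₁ - (b - x * T)) / 6 with hε
  have hε0 : 0 < ε := div_pos (sub_pos.2 (EReal.coe_lt_coe_iff.1 hbb₁)) (by norm_num)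
  -- the denominator `x + 1` makes the loss `x (T - τ)` at most `ε`, also when `x = 0`
  set τ := T - ε / (x + 1) with hτ
  have hτT : τ < T := sub_lt_self _ (by positivity)
  have hxτ : x * T - ε ≤ x * τ := by
    have : x * (ε / (x + 1)) ≤ ε := by
      rw [← mul_div_assoc, div_le_iff₀ (by positivity)]
      nlinarith
    rw [hτ, mul_sub]
    linarith
  set f : ℕ+ → ℝ := fun r => c r * Real.exp (r * τ) with hf
  have hfs : Summable f := hT τ hτT
  set h : ℕ+ → ℝ := fun r => (ℓ r : ℝ) * Real.log ((ℓ r : ℝ) / c r) - (ℓ r : ℝ) + c r with hh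
  have hev1 : ∀ᶠ s : Finset ℕ+ in atTop, b₁ < ∑ r ∈ s, h r :=
    eventually_lt_sum_of_lt_tsum_ofReal
      (fun r => entropy_term_nonneg (ℓ r).coe_nonneg (hc r)) hb₁
  have hev2 : ∀ᶠ s : Finset ℕ+ in atTop, ∑' r, f r - ε < ∑ r ∈ s, f r :=
    hfs.hasSum.eventually (lt_mem_nhds (by linarith))
  have hev3 : ∀ᶠ s : Finset ℕ+ in atTop,
      x * τ - ε < (ρ - ∑ r ∈ s, (r : ℝ) * (ℓ r : ℝ)) * τ :=
    ((hℓ.hasSum.const_sub ρ).mul_const τ).eventually (lt_mem_nhds (by rw [← hxdef]; linarith))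
  obtain ⟨s, h1, h2, h3⟩ := (hev1.and (hev2.and hev3)).exists
  set δ := ε / (s.card + 1) with hδ
  have hδ0 : 0 < δ := by positivity
  have hsδ : s.card * δ ≤ ε := by
    rw [hδ, ← mul_div_assoc, div_le_iff₀ (by positivity)]
    nlinarith
  set θ : ℕ+ → ℝ := fun r => if r ∈ s then Real.log (((ℓ r : ℝ) + δ) / c r) else r * τ with hθ
  have hθs : ∀ r ∈ s, c r * Real.exp (θ r) = ℓ r + δ := by
    intro r hr
    have : 0 < (ℓ r : ℝ) + δ := add_pos_of_nonneg_of_pos (ℓ r).coe_nonneg hδ0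
    simp only [hθ, hr, if_true]
    rw [Real.exp_log (div_pos this (hc r)), mul_div_cancel₀ _ (hc r).ne']
  have hθn : ∀ r, r ∉ s → θ r = r * τ := fun r hr => by simp [hθ, hr]
  have hsum : HasSum (fun r => c r * Real.exp (θ r))
      (∑' r, f r + ∑ r ∈ s, (c r * Real.exp (θ r) - f r)) := by
    have := hfs.hasSum.add (hasSum_sum_of_ne_finset_zero
      (f := fun r => c r * Real.exp (θ r) - f r) (s := s) fun r hr => by simp [hf, hθn r hr])
    simpa using this
  have hd : ∑' r, c r * Real.exp (θ r)
      = ∑' r, f r + (∑ r ∈ s, (ℓ r : ℝ) + s.card * δ - ∑ r ∈ s, f r) := by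
    rw [hsum.tsum_eq, Finset.sum_sub_distrib, Finset.sum_congr rfl hθs, Finset.sum_add_distrib,
      Finset.sum_const, nsmul_eq_mul]
  set L : (ℕ+ → ℝ≥0) → ℝ := fun y => ∑ r ∈ s, (θ r - r * τ) * (y r : ℝ) with hL
  have hLc : Continuous L := by fun_prop
  have hLℓ : ∑ r ∈ s, (h r - c r + ℓ r) - (∑ r ∈ s, (r : ℝ) * (ℓ r : ℝ)) * τ ≤ L ℓ := by
    rw [hL, Finset.sum_mul, ← Finset.sum_sub_distrib]
    refine Finset.sum_le_sum fun r hr => ?_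
    have hle : (ℓ r : ℝ) * Real.log ((ℓ r : ℝ) / c r) ≤ θ r * ℓ r := by
      rcases (ℓ r).coe_nonneg.eq_or_lt with h0 | h0
      · rw [← h0]; simp
      · rw [mul_comm]
        refine mul_le_mul_of_nonneg_right ?_ h0.le
        simp only [hθ, hr, if_true]
        refine Real.log_le_log (div_pos h0 (hc r)) ?_
        have := (hc r).le
        gcongr
        linarith
    simp only [hh]
    linarith
  have hcsle : ∑ r ∈ s, c r ≤ ∑' r, c r := hcs.sum_le_tsum s fun r _ => (hc r).le
  refine ⟨{y | L ℓ - ε < L y}, isOpen_lt continuous_const hLc, ?_, ?_⟩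
  · exact sub_lt_self _ hε0
  -- six errors `ε` at most are lost: `τ`, the tail of `f`, the tail of the mass, `δ`, the
  -- neighbourhood of `ℓ`, and the convergence of `M / V`
  have hMτ : ∀ᶠ n in atTop, ρ * τ - ε < (M n : ℝ) / V n * τ :=
    (hM.mul_const τ).eventually (lt_mem_nhds (by linarith))
  filter_upwards [hMτ] with n hn
  have hVn := hVpos n
  refine (gibbsSum_le_of_tilt hc hsum.summable hθn hVn (M n) (B := L ℓ - ε)
    fun y hy => (show L ℓ - ε < L y from hy).le).trans ?_
  rw [← Real.exp_add, Real.exp_le_exp]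
  have hMn : (M n : ℝ) * τ = V n * ((M n : ℝ) / V n * τ) := by field_simp
  rw [hMn, ← mul_add, ← mul_neg, ← mul_add]
  refine mul_le_mul_of_nonneg_left ?_ hVn.le
  rw [Finset.sum_add_distrib, Finset.sum_sub_distrib] at hLℓ
  rw [hd]
  have hε6 : 6 * ε = b₁ - (b - x * T) := by rw [hε]; ring
  linarith

/-! ### The local lower estimate at finitely supported profiles -/

theorem log_factorial_le (k : ℕ) :
    Real.log (k.factorial : ℝ) ≤ k * Real.log k - k + Real.log k + 1 := by
  induction k with
  | zero => simp
  | succ k ih =>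
    rcases Nat.eq_zero_or_pos k with rfl | hk
    · simp
    have hk0 : (0 : ℝ) < k := by exact_mod_cast hk
    rw [Nat.factorial_succ]
    push_cast
    rw [Real.log_mul (by positivity) (by positivity)]
    have h1 : 1 / ((k : ℝ) + 1) ≤ Real.log (k + 1) - Real.log k := by
      have := Real.one_sub_inv_le_log_of_pos (x := ((k : ℝ) + 1) / k) (by positivity)
      rw [Real.log_div (by positivity) hk0.ne', inv_div] at this
      refine le_trans (le_of_eq ?_) this
      field_simp
      ring
    rw [div_le_iff₀ (by positivity)] at h1
    linarith

theorem mul_log_div_eq (x : ℝ) {c : ℝ} (hc : 0 < c) :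
    x * Real.log (x / c) = x * Real.log x - x * Real.log c := by
  rcases eq_or_ne x 0 with rfl | hx
  · simp
  · rw [Real.log_div hx hc.ne']; ring

theorem continuous_sub_mul_log_div {c : ℝ} (hc : 0 < c) :
    Continuous fun x : ℝ => x - x * Real.log (x / c) := by
  simp only [mul_log_div_eq _ hc]
  exact continuous_id.sub (Real.continuous_mul_log.sub (continuous_id.mul continuous_const))

/-- Stirling asymptotics of Poisson weights, lower half. -/
theorem eventually_exp_le_pow_div_factorial {V : ℕ → ℝ} (hVpos : ∀ n, 0 < V n)
    (hV : Tendsto V atTop atTop) {k : ℕ → ℕ} {x c b : ℝ} (hc : 0 < c)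
    (hk : Tendsto (fun n => (k n : ℝ) / V n) atTop (𝓝 x))
    (hb : b < x - x * Real.log (x / c)) :
    ∀ᶠ n in atTop, Real.exp (V n * b) ≤ (V n * c) ^ k n / ((k n).factorial : ℝ) := by
  have hlogV : Tendsto (fun n => Real.log (V n) / V n) atTop (𝓝 0) :=
    Real.isLittleO_log_id_atTop.tendsto_div_nhds_zero.comp hV
  have hinv : Tendsto (fun n => (V n)⁻¹) atTop (𝓝 0) := tendsto_inv_atTop_zero.comp hV
  -- the error in `log k !` is at most `log k + 1`, and `log k ≤ log (|x| + 1) + log V`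
  have hlim : Tendsto (fun n => ((k n : ℝ) / V n - (k n : ℝ) / V n * Real.log ((k n : ℝ) / V n / c))
      - (Real.log (|x| + 1) * (V n)⁻¹ + Real.log (V n) / V n + (V n)⁻¹)) atTop
      (𝓝 (x - x * Real.log (x / c))) := by
    have h := (((continuous_sub_mul_log_div hc).tendsto x).comp hk).sub
      (((hinv.const_mul (Real.log (|x| + 1))).add hlogV).add hinv)
    simpa using h
  filter_upwards [hlim.eventually (lt_mem_nhds hb), hk.eventually (gt_mem_nhds
    (show x < |x| + 1 by linarith [le_abs_self x])), hV.eventually_ge_atTop 1] with n h1 h2 h3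
  have hVn := hVpos n
  have hfac : (0 : ℝ) < ((k n).factorial : ℝ) := by exact_mod_cast Nat.factorial_pos _
  rw [← Real.le_log_iff_exp_le (by positivity), Real.log_div (by positivity) hfac.ne',
    Real.log_pow, Real.log_mul hVn.ne' hc.ne']
  have hlogk : Real.log (k n) ≤ Real.log (|x| + 1) + Real.log (V n) := by
    rw [← Real.log_mul (by positivity) hVn.ne']
    rcases Nat.eq_zero_or_pos (k n) with h0 | h0
    · rw [h0, Nat.cast_zero, Real.log_zero]
      exact Real.log_nonneg (by nlinarith [abs_nonneg x])
    · exact Real.log_le_log (by exact_mod_cast h0) ((div_lt_iff₀ hVn).1 h2).le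
  have hy : V n * ((k n : ℝ) / V n * Real.log ((k n : ℝ) / V n / c))
      = k n * Real.log (k n) - k n * Real.log (V n) - k n * Real.log c := by
    rw [mul_log_div_eq _ hc]
    rcases Nat.eq_zero_or_pos (k n) with h0 | h0
    · simp [h0]
    · have : (k n : ℝ) ≠ 0 := by exact_mod_cast h0.ne'
      rw [Real.log_div this hVn.ne']
      field_simp
  have h4 := mul_le_mul_of_nonneg_left h1.le hVn.le
  have h5 : V n * (((k n : ℝ) / V n - (k n : ℝ) / V n * Real.log ((k n : ℝ) / V n / c))
      - (Real.log (|x| + 1) * (V n)⁻¹ + Real.log (V n) / V n + (V n)⁻¹))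
      = k n - (k n * Real.log (k n) - k n * Real.log (V n) - k n * Real.log c)
        - (Real.log (|x| + 1) + Real.log (V n) + 1) := by
    rw [mul_sub, mul_sub, hy]
    field_simp
  rw [h5] at h4
  have h6 := log_factorial_le (k n)
  linarith

/-- Every neighbourhood of `ℓ` carries Gibbs weight at least `exp (V (a - o(1)))`. -/
def HasExpLowerBound (c : ℕ+ → ℝ) (V : ℕ → ℝ) (M : ℕ → ℕ) (ℓ : ℕ+ → ℝ≥0) (a : ℝ) : Prop :=
  ∀ G, IsOpen G → ℓ ∈ G → ∀ b < a, ∀ᶠ n in atTop,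
    Real.exp (V n * b) ≤ gibbsSum c (V n) (M n) G

theorem HasExpLowerBound.of_tendsto {c : ℕ+ → ℝ} {V : ℕ → ℝ} {M : ℕ → ℕ} {ι : Type*}
    {F : Filter ι} [F.NeBot] {u : ι → ℕ+ → ℝ≥0} {ℓ : ℕ+ → ℝ≥0} {a : ι → ℝ} {a' : ℝ}
    (hu : Tendsto u F (𝓝 ℓ)) (ha : Tendsto a F (𝓝 a'))
    (h : ∀ᶠ i in F, HasExpLowerBound c V M (u i) (a i)) : HasExpLowerBound c V M ℓ a' := by
  intro G hG hℓ b hb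
  obtain ⟨i, h1, h2, h3⟩ :=
    (h.and ((hu.eventually (hG.mem_nhds hℓ)).and (ha.eventually (lt_mem_nhds hb)))).exists
  exact h1 G hG h2 b h3

/-- A profile with finitely many sizes that contains clusters of size `1` and has exactly the
mass `ρ`. One state suffices: round all counts down and adjust the number of clusters of size
`1` to reach mass `M`. -/
theorem hasExpLowerBound_of_mass_eq {c : ℕ+ → ℝ} (hc : ∀ r, 0 < c r) {ρ : ℝ}
    {V : ℕ → ℝ} (hVpos : ∀ n, 0 < V n) (hV : Tendsto V atTop atTop) {M : ℕ → ℕ}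
    (hM : Tendsto (fun n => (M n : ℝ) / V n) atTop (𝓝 ρ)) {ℓ : ℕ+ → ℝ≥0} {s : Finset ℕ+}
    (h1s : 1 ∈ s) (hs : ∀ r, r ∉ s → ℓ r = 0) (h1 : 0 < ℓ 1)
    (hmass : ∑ r ∈ s, (r : ℝ) * (ℓ r : ℝ) = ρ) :
    HasExpLowerBound c V M ℓ
      (∑ r ∈ s, ((ℓ r : ℝ) - (ℓ r : ℝ) * Real.log ((ℓ r : ℝ) / c r))) := by
  classical
  intro G hG hℓG b hb
  set fl : ℕ → ℕ+ → ℕ := fun n r => ⌊(ℓ r : ℝ) * V n⌋₊ with hfl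
  set rest : ℕ → ℕ := fun n => ∑ r ∈ s.erase 1, (r : ℕ) * fl n r with hrest
  set η : ℕ → ℕ+ →₀ ℕ := fun n =>
    Finsupp.onFinset s (fun r => if r = 1 then M n - rest n else fl n r) (by
      intro r hr
      by_contra hrs
      have : r ≠ 1 := fun h => hrs (h ▸ h1s)
      simp [this, hfl, hs r hrs] at hr) with hη
  have hη1 : ∀ n, η n 1 = M n - rest n := fun n => by simp [hη]
  have hηr : ∀ n r, r ≠ 1 → η n r = fl n r := fun n r hr => by simp [hη, hr]
  have hsupp : ∀ n, (η n).support ⊆ s := fun n => Finsupp.support_onFinset_subset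
  have hfllim : ∀ r, Tendsto (fun n => (fl n r : ℝ) / V n) atTop (𝓝 (ℓ r)) := fun r =>
    (tendsto_nat_floor_mul_div_atTop (ℓ r).coe_nonneg).comp hV
  have hsplit : (ℓ 1 : ℝ) = ρ - ∑ r ∈ s.erase 1, (r : ℝ) * (ℓ r : ℝ) := by
    rw [← hmass, ← Finset.add_sum_erase s _ h1s]
    simp
  have hrestlim : Tendsto (fun n => ((M n : ℝ) - rest n) / V n) atTop (𝓝 (ℓ 1)) := by
    rw [hsplit]
    have h := hM.sub (tendsto_finsetSum (s.erase 1) fun r _ => (hfllim r).const_mul (r : ℝ))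
    refine h.congr fun n => ?_
    simp only [hrest]
    push_cast
    rw [sub_div, Finset.sum_div]
    simp only [mul_div_assoc]
  have hpos : ∀ᶠ n in atTop, rest n ≤ M n := by
    filter_upwards [hrestlim.eventually (lt_mem_nhds (show (0 : ℝ) < ℓ 1 from h1))] with n hn
    have := (div_pos_iff_of_pos_right (hVpos n)).1 hn
    exact_mod_cast (sub_pos.1 this).le
  have hlim : ∀ r, Tendsto (fun n => (η n r : ℝ) / V n) atTop (𝓝 (ℓ r)) := by
    intro r
    by_cases hr : r = 1
    · subst hr
      refine hrestlim.congr' ?_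
      filter_upwards [hpos] with n hn
      rw [hη1, Nat.cast_sub hn]
    · simp only [hηr _ r hr]
      exact hfllim r
  have hmassη : ∀ᶠ n in atTop, η n ∈ states (M n) := by
    filter_upwards [hpos] with n hn
    rw [mem_states, mass, Finsupp.sum_of_support_subset _ (hsupp n) _ (by simp),
      ← Finset.add_sum_erase s _ h1s, hη1,
      Finset.sum_congr rfl fun r hr => by rw [hηr n r (Finset.ne_of_mem_erase hr)]]
    simp only [PNat.one_coe, one_mul]
    exact Nat.sub_add_cancel hn
  have hsc : Tendsto (fun n => scaledCounts (V n) (η n)) atTop (𝓝 ℓ) := by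
    refine tendsto_pi_nhds.2 fun r => ?_
    have := (continuous_real_toNNReal.tendsto _).comp (hlim r)
    rwa [Real.toNNReal_coe] at this
  set ε := (∑ r ∈ s, ((ℓ r : ℝ) - (ℓ r : ℝ) * Real.log ((ℓ r : ℝ) / c r)) - b) / (s.card + 1)
    with hε
  have hε0 : 0 < ε := div_pos (sub_pos.2 hb) (by positivity)
  have hprod : ∀ᶠ n in atTop, ∀ r ∈ s,
      Real.exp (V n * ((ℓ r : ℝ) - (ℓ r : ℝ) * Real.log ((ℓ r : ℝ) / c r) - ε))
        ≤ (V n * c r) ^ η n r / ((η n r).factorial : ℝ) :=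
    (Finset.eventually_all s).2 fun r _ =>
      eventually_exp_le_pow_div_factorial hVpos hV (hc r) (hlim r) (sub_lt_self _ hε0)
  filter_upwards [hmassη, hsc.eventually (hG.mem_nhds hℓG), hprod] with n hn1 hn2 hn3
  have hVn := hVpos n
  calc Real.exp (V n * b)
      ≤ Real.exp (∑ r ∈ s,
          V n * ((ℓ r : ℝ) - (ℓ r : ℝ) * Real.log ((ℓ r : ℝ) / c r) - ε)) := by
        rw [Real.exp_le_exp, ← Finset.mul_sum, Finset.sum_sub_distrib _ (fun _ => ε),
          Finset.sum_const, nsmul_eq_mul]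
        refine mul_le_mul_of_nonneg_left ?_ hVn.le
        have : (s.card + 1) * ε
            = ∑ r ∈ s, ((ℓ r : ℝ) - (ℓ r : ℝ) * Real.log ((ℓ r : ℝ) / c r)) - b := by
          rw [hε]; field_simp
        linarith
    _ ≤ weight c (V n) (η n) := by
        rw [Real.exp_sum, weight, Finsupp.prod_of_support_subset _ (hsupp n) _ (by simp)]
        exact Finset.prod_le_prod (fun r _ => (Real.exp_pos _).le) hn3
    _ ≤ gibbsSum c (V n) (M n) G := by
        rw [gibbsSum]
        exact Finset.single_le_sum (f := fun η => weight c (V n) η)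
          (fun η _ => (weight_pos hc hVn η).le) (Finset.mem_filter.2 ⟨hn1, hn2⟩)

/-! ### The local lower estimate in general -/

/-- The missing mass `ρ - ∑ r ℓ_r` is put into clusters of one large size `R`; as `R → ∞` this
costs `T` per unit of mass. -/
theorem hasExpLowerBound_of_one_pos {c : ℕ+ → ℝ} (hc : ∀ r, 0 < c r) {T : ℝ}
    (hcT : Tendsto (fun r : ℕ+ => Real.log (c r) / r) atTop (𝓝 (-T))) {ρ : ℝ}
    {V : ℕ → ℝ} (hVpos : ∀ n, 0 < V n) (hV : Tendsto V atTop atTop) {M : ℕ → ℕ}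
    (hM : Tendsto (fun n => (M n : ℝ) / V n) atTop (𝓝 ρ)) {ℓ : ℕ+ → ℝ≥0} {s : Finset ℕ+}
    (h1s : 1 ∈ s) (hs : ∀ r, r ∉ s → ℓ r = 0) (h1 : 0 < ℓ 1)
    (hmass : ∑ r ∈ s, (r : ℝ) * (ℓ r : ℝ) ≤ ρ) :
    HasExpLowerBound c V M ℓ
      (∑ r ∈ s, ((ℓ r : ℝ) - (ℓ r : ℝ) * Real.log ((ℓ r : ℝ) / c r))
        - (ρ - ∑ r ∈ s, (r : ℝ) * (ℓ r : ℝ)) * T) := by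
  classical
  set x := ρ - ∑ r ∈ s, (r : ℝ) * (ℓ r : ℝ) with hx
  have hx0 : 0 ≤ x := sub_nonneg.2 hmass
  set y : ℕ+ → ℝ≥0 := fun R => Real.toNNReal (x / R) with hy
  have hyR : ∀ R : ℕ+, (y R : ℝ) = x / R := fun R => Real.coe_toNNReal _ (by positivity)
  have hcast : Tendsto (fun R : ℕ+ => (R : ℝ)) atTop atTop :=
    tendsto_natCast_atTop_atTop.comp tendsto_PNat_val_atTop_atTop
  have hinv : Tendsto (fun R : ℕ+ => (R : ℝ)⁻¹) atTop (𝓝 0) := tendsto_inv_atTop_zero.comp hcast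
  have hlog : Tendsto (fun R : ℕ+ => Real.log (R : ℝ) / R) atTop (𝓝 0) :=
    Real.isLittleO_log_id_atTop.tendsto_div_nhds_zero.comp hcast
  have hcost : Tendsto (fun R : ℕ+ => (y R : ℝ) - (y R : ℝ) * Real.log ((y R : ℝ) / c R)) atTop
      (𝓝 (-(x * T))) := by
    have h := (hinv.const_mul x).sub ((((hinv.const_mul (Real.log x)).sub hlog).sub hcT).const_mul x)
    have hlimeq : x * 0 - x * (Real.log x * 0 - 0 - -T) = -(x * T) := by ring
    rw [hlimeq] at h
    refine h.congr fun R => ?_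
    have hR : (0 : ℝ) < R := by exact_mod_cast R.pos
    rw [hyR]
    rcases hx0.eq_or_lt with h0 | h0
    · rw [← h0]; simp
    · rw [Real.log_div (div_pos h0 hR).ne' (hc R).ne', Real.log_div h0.ne' hR.ne']
      field_simp
  have hnotin : ∀ᶠ R : ℕ+ in atTop, R ∉ s :=
    atTop_le_cofinite s.finite_toSet.compl_mem_cofinite
  refine HasExpLowerBound.of_tendsto (F := (atTop : Filter ℕ+))
    (u := fun R => Function.update ℓ R (y R))
    (a := fun R => ((y R : ℝ) - (y R : ℝ) * Real.log ((y R : ℝ) / c R))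
      + ∑ r ∈ s, ((ℓ r : ℝ) - (ℓ r : ℝ) * Real.log ((ℓ r : ℝ) / c r))) ?_ ?_ ?_
  · refine tendsto_pi_nhds.2 fun r => tendsto_const_nhds.congr' ?_
    filter_upwards [eventually_gt_atTop r] with R hR
    rw [Function.update_of_ne hR.ne]
  · have := hcost.add_const
      (∑ r ∈ s, ((ℓ r : ℝ) - (ℓ r : ℝ) * Real.log ((ℓ r : ℝ) / c r)))
    rwa [neg_add_eq_sub] at this
  · filter_upwards [hnotin] with R hR
    have hne : ∀ r ∈ s, r ≠ R := fun r hr h => hR (h ▸ hr)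
    have hR0 : (R : ℝ) ≠ 0 := by exact_mod_cast R.ne_zero
    have hbd := hasExpLowerBound_of_mass_eq hc hVpos hV hM (ℓ := Function.update ℓ R (y R))
      (s := insert R s) (Finset.mem_insert_of_mem h1s) (fun r hr => by
        rw [Finset.mem_insert, not_or] at hr
        rw [Function.update_of_ne hr.1, hs r hr.2])
      (by rwa [Function.update_of_ne (hne 1 h1s)])
      (by
        rw [Finset.sum_insert hR, Function.update_self,
          Finset.sum_congr rfl fun r hr => by rw [Function.update_of_ne (hne r hr)], hyR,
          mul_div_cancel₀ _ hR0, hx, sub_add_cancel])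
    rw [Finset.sum_insert hR, Function.update_self,
      Finset.sum_congr rfl fun r hr => by rw [Function.update_of_ne (hne r hr)]] at hbd
    exact hbd

/-- Finitely supported profiles are approached along the segment to the profile `(ρ, 0, 0, …)`,
on which the number of clusters of size `1` is positive. -/
theorem hasExpLowerBound_of_finite_support {c : ℕ+ → ℝ} (hc : ∀ r, 0 < c r) {T : ℝ}
    (hcT : Tendsto (fun r : ℕ+ => Real.log (c r) / r) atTop (𝓝 (-T))) {ρ : ℝ} (hρ : 0 < ρ)
    {V : ℕ → ℝ} (hVpos : ∀ n, 0 < V n) (hV : Tendsto V atTop atTop) {M : ℕ → ℕ}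
    (hM : Tendsto (fun n => (M n : ℝ) / V n) atTop (𝓝 ρ)) {ℓ : ℕ+ → ℝ≥0} {s : Finset ℕ+}
    (h1s : 1 ∈ s) (hs : ∀ r, r ∉ s → ℓ r = 0)
    (hmass : ∑ r ∈ s, (r : ℝ) * (ℓ r : ℝ) ≤ ρ) :
    HasExpLowerBound c V M ℓ
      (∑ r ∈ s, ((ℓ r : ℝ) - (ℓ r : ℝ) * Real.log ((ℓ r : ℝ) / c r))
        - (ρ - ∑ r ∈ s, (r : ℝ) * (ℓ r : ℝ)) * T) := by
  classical
  set u : ℝ → ℕ+ → ℝ≥0 := fun t r =>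
    Real.toNNReal ((1 - t) * (ℓ r : ℝ) + if r = 1 then t * ρ else 0) with hu
  have huc : ∀ r, Continuous fun t => u t r := by
    intro r
    refine continuous_real_toNNReal.comp ?_
    split_ifs <;> fun_prop
  have hu0 : u 0 = ℓ := by
    ext r
    simp [hu]
  have hut : ∀ t, 0 < t → t < 1 → ∀ r,
      (u t r : ℝ) = (1 - t) * (ℓ r : ℝ) + if r = 1 then t * ρ else 0 := by
    intro t ht0 ht1 r
    refine Real.coe_toNNReal _ (add_nonneg (mul_nonneg (by linarith) (ℓ r).coe_nonneg) ?_)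
    split_ifs <;> positivity
  refine HasExpLowerBound.of_tendsto (F := 𝓝[>] (0 : ℝ)) (u := u)
    (a := fun t => ∑ r ∈ s, ((u t r : ℝ) - (u t r : ℝ) * Real.log ((u t r : ℝ) / c r))
        - (ρ - ∑ r ∈ s, (r : ℝ) * (u t r : ℝ)) * T) ?_ ?_ ?_
  · exact ((continuous_pi huc).tendsto' 0 ℓ hu0).mono_left nhdsWithin_le_nhds
  · have huc' : ∀ r, Continuous fun t => (u t r : ℝ) := fun r =>
      NNReal.continuous_coe.comp (huc r)
    have hcont : Continuous fun t =>
        ∑ r ∈ s, ((u t r : ℝ) - (u t r : ℝ) * Real.log ((u t r : ℝ) / c r))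
        - (ρ - ∑ r ∈ s, (r : ℝ) * (u t r : ℝ)) * T := by
      refine (continuous_finsetSum _ fun r _ =>
        (continuous_sub_mul_log_div (hc r)).comp (huc' r)).sub ?_
      exact (continuous_const.sub (continuous_finsetSum _ fun r _ =>
        continuous_const.mul (huc' r))).mul continuous_const
    exact (hcont.tendsto' 0 _ (by rw [hu0])).mono_left nhdsWithin_le_nhds
  · filter_upwards [Ioo_mem_nhdsGT (show (0 : ℝ) < 1 by norm_num)] with t ht
    obtain ⟨ht0, ht1⟩ := ht
    refine hasExpLowerBound_of_one_pos hc hcT hVpos hV hM h1s (fun r hr => ?_) ?_ ?_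
    · have : r ≠ 1 := fun h => hr (h ▸ h1s)
      simp [hu, hs r hr, this]
    · have h := hut t ht0 ht1 1
      rw [if_pos rfl] at h
      have : (0 : ℝ) < u t 1 := by
        rw [h]
        exact add_pos_of_nonneg_of_pos (mul_nonneg (by linarith) (ℓ 1).coe_nonneg)
          (mul_pos ht0 hρ)
      exact this
    · simp only [hut t ht0 ht1, mul_add, Finset.sum_add_distrib, mul_ite, mul_zero,
        Finset.sum_ite_eq', h1s, if_true]
      have : ∑ r ∈ s, (r : ℝ) * ((1 - t) * (ℓ r : ℝ))
          = (1 - t) * ∑ r ∈ s, (r : ℝ) * (ℓ r : ℝ) := by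
        rw [Finset.mul_sum]
        exact Finset.sum_congr rfl fun r _ => by ring
      rw [this]
      simp only [PNat.one_coe, Nat.cast_one, one_mul]
      nlinarith

/-- Truncating `ℓ` to finite sets of sizes moves the lost mass into the deficit; the bounds for the
truncations converge to the rate at `ℓ`. -/
theorem hasExpLowerBound {c : ℕ+ → ℝ} (hc : ∀ r, 0 < c r) (hcs : Summable c) {T : ℝ}
    (hcT : Tendsto (fun r : ℕ+ => Real.log (c r) / r) atTop (𝓝 (-T))) {ρ : ℝ} (hρ : 0 < ρ)
    {V : ℕ → ℝ} (hVpos : ∀ n, 0 < V n) (hV : Tendsto V atTop atTop) {M : ℕ → ℕ}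
    (hM : Tendsto (fun n => (M n : ℝ) / V n) atTop (𝓝 ρ)) {ℓ : ℕ+ → ℝ≥0}
    (hℓ : Summable fun r : ℕ+ => (r : ℝ) * (ℓ r : ℝ)) (hx : ∑' r : ℕ+, (r : ℝ) * (ℓ r : ℝ) ≤ ρ)
    (hH : relEntropy ℓ c ≠ ∞) :
    HasExpLowerBound c V M ℓ (∑' r, c r - (relEntropy ℓ c).toReal
      - (ρ - ∑' r : ℕ+, (r : ℝ) * (ℓ r : ℝ)) * T) := by
  classical
  have hh0 : ∀ r, 0 ≤ (ℓ r : ℝ) * Real.log ((ℓ r : ℝ) / c r) - (ℓ r : ℝ) + c r := fun r =>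
    entropy_term_nonneg (ℓ r).coe_nonneg (hc r)
  have hhs : HasSum (fun r => (ℓ r : ℝ) * Real.log ((ℓ r : ℝ) / c r) - (ℓ r : ℝ) + c r)
      (relEntropy ℓ c).toReal := by
    have h := ENNReal.hasSum_toReal hH
    rw [relEntropy, ENNReal.tsum_toReal_eq fun r => ENNReal.ofReal_ne_top]
    simpa only [ENNReal.toReal_ofReal (hh0 _)] using h
  refine HasExpLowerBound.of_tendsto (F := (atTop : Filter (Finset ℕ+)))
    (u := fun s r => if r ∈ s then ℓ r else 0)
    (a := fun s => ∑ r ∈ s, (c r - ((ℓ r : ℝ) * Real.log ((ℓ r : ℝ) / c r) - (ℓ r : ℝ) + c r))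
      - (ρ - ∑ r ∈ s, (r : ℝ) * (ℓ r : ℝ)) * T) ?_ ?_ ?_
  · refine tendsto_pi_nhds.2 fun r => tendsto_const_nhds.congr' ?_
    filter_upwards [eventually_ge_atTop {r}] with s hs
    rw [if_pos (hs (Finset.mem_singleton_self r))]
  · exact Tendsto.sub (hcs.hasSum.sub hhs) ((hℓ.hasSum.const_sub ρ).mul_const T)
  · filter_upwards [eventually_ge_atTop {1}] with s hs
    have h1s : (1 : ℕ+) ∈ s := hs (Finset.mem_singleton_self 1)
    have hsum : ∑ r ∈ s, (r : ℝ) * ((if r ∈ s then ℓ r else 0 : ℝ≥0) : ℝ)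
        = ∑ r ∈ s, (r : ℝ) * (ℓ r : ℝ) :=
      Finset.sum_congr rfl fun r hr => by rw [if_pos hr]
    have hle : ∑ r ∈ s, (r : ℝ) * (ℓ r : ℝ) ≤ ρ :=
      (hℓ.sum_le_tsum s fun r _ => by positivity).trans hx
    have hbd := hasExpLowerBound_of_finite_support hc hcT hρ hVpos hV hM
      (ℓ := fun r => if r ∈ s then ℓ r else 0) h1s (fun r hr => if_neg hr) (hsum.trans_le hle)
    rw [hsum] at hbd
    convert hbd using 2
    refine Finset.sum_congr rfl fun r hr => ?_
    rw [if_pos hr]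
    ring

/-! ### The mass functional on profiles -/

/-- The mass `∑ r y_r ∈ [0, ∞]` of a profile. -/
noncomputable def profileMass (y : ℕ+ → ℝ≥0) : ℝ≥0∞ := ∑' r : ℕ+, (r : ℝ≥0∞) * (y r : ℝ≥0∞)

theorem lowerSemicontinuous_profileMass : LowerSemicontinuous profileMass := by
  refine lowerSemicontinuous_tsum fun r => Continuous.lowerSemicontinuous ?_
  exact (ENNReal.continuous_const_mul (ENNReal.natCast_ne_top _)).comp
    (ENNReal.continuous_coe.comp (continuous_apply r))

theorem isOpen_lt_profileMass (q : ℝ≥0∞) : IsOpen {y | q < profileMass y} :=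
  lowerSemicontinuous_profileMass.isOpen_preimage q

theorem isCompact_profileMass_le {q : ℝ≥0∞} (hq : q ≠ ∞) : IsCompact {y | profileMass y ≤ q} := by
  refine (isCompact_univ_pi fun _ : ℕ+ => isCompact_Icc (a := (0 : ℝ≥0)) (b := q.toNNReal))
    |>.of_isClosed_subset (lowerSemicontinuous_profileMass.isClosed_preimage q) ?_
  intro y hy r _
  refine ⟨zero_le, ?_⟩
  rw [← ENNReal.coe_le_coe, ENNReal.coe_toNNReal hq]
  refine le_trans ?_ ((ENNReal.le_tsum r).trans hy)
  exact le_mul_of_one_le_left' (by exact_mod_cast r.pos)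

theorem ofReal_mul_coe (r : ℕ+) (x : ℝ≥0) :
    ENNReal.ofReal ((r : ℝ) * (x : ℝ)) = (r : ℝ≥0∞) * (x : ℝ≥0∞) := by
  rw [ENNReal.ofReal_mul (Nat.cast_nonneg _), ENNReal.ofReal_natCast, ENNReal.ofReal_coe_nnreal]

theorem profileMass_scaledCounts {V : ℝ} (hV : 0 < V) (η : ℕ+ →₀ ℕ) :
    profileMass (scaledCounts V η) = ENNReal.ofReal (mass η / V) := by
  have h : ∀ r : ℕ+, (r : ℝ≥0∞) * (scaledCounts V η r : ℝ≥0∞)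
      = ENNReal.ofReal ((r : ℝ) * η r / V) := by
    intro r
    rw [← ofReal_mul_coe, scaledCounts, Real.coe_toNNReal _ (by positivity), mul_div_assoc]
  rw [profileMass, tsum_congr h, tsum_eq_sum (s := η.support) fun r hr => by
      simp [Finsupp.notMem_support_iff.1 hr],
    ← ENNReal.ofReal_sum_of_nonneg fun r _ => by positivity, ← Finset.sum_div, mass, Finsupp.sum]
  push_cast
  rfl

theorem eventually_gibbsSum_eq_zero (c : ℕ+ → ℝ) {ρ : ℝ} {V : ℕ → ℝ} (hVpos : ∀ n, 0 < V n)
    {M : ℕ → ℕ} (hM : Tendsto (fun n => (M n : ℝ) / V n) atTop (𝓝 ρ)) {q : ℝ≥0∞}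
    (hq : ENNReal.ofReal ρ < q) :
    ∀ᶠ n in atTop, gibbsSum c (V n) (M n) {y | q < profileMass y} = 0 := by
  classical
  filter_upwards [((ENNReal.continuous_ofReal.tendsto ρ).comp hM).eventually (gt_mem_nhds hq)]
    with n hn
  generalize hU : {y : ℕ+ → ℝ≥0 | q < profileMass y} = U
  refine Finset.sum_eq_zero fun η hη => ?_
  obtain ⟨h1, h2⟩ := Finset.mem_filter.1 hη
  rw [← hU, Set.mem_ofPred_eq, profileMass_scaledCounts (hVpos n), mem_states.1 h1] at h2
  exact absurd h2 hn.le.not_gt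

theorem hasSum_of_profileMass_le {ρ : ℝ} (hρ : 0 ≤ ρ) {y : ℕ+ → ℝ≥0}
    (h : profileMass y ≤ ENNReal.ofReal ρ) :
    (Summable fun r : ℕ+ => (r : ℝ) * (y r : ℝ)) ∧ ∑' r : ℕ+, (r : ℝ) * (y r : ℝ) ≤ ρ := by
  have hnn : ∀ r : ℕ+, 0 ≤ (r : ℝ) * (y r : ℝ) := fun r => by positivity
  have heq : profileMass y = ∑' r : ℕ+, ENNReal.ofReal ((r : ℝ) * (y r : ℝ)) :=
    tsum_congr fun r => (ofReal_mul_coe r (y r)).symm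
  have hs : Summable fun r : ℕ+ => (r : ℝ) * (y r : ℝ) := by
    have := ENNReal.summable_toReal (heq ▸ ne_top_of_le_ne_top ENNReal.ofReal_ne_top h)
    simpa only [ENNReal.toReal_ofReal (hnn _)] using this
  refine ⟨hs, ?_⟩
  rwa [heq, ← ENNReal.ofReal_tsum_of_nonneg hnn hs, ENNReal.ofReal_le_ofReal_iff hρ] at h

/-! ### The large deviation principle -/

theorem relEntropy_self {c : ℕ+ → ℝ} (hc : ∀ r, 0 < c r) :
    relEntropy (fun r => Real.toNNReal (c r)) c = 0 := by
  rw [relEntropy, ENNReal.tsum_eq_zero]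
  intro r
  rw [Real.coe_toNNReal _ (hc r).le, div_self (hc r).ne']
  simp

/-- The large deviation principle for activities `c` that are already tilted to be an equilibrium
profile: `c` has mass at most `ρ`, and the deficit, if any, costs nothing. The profile `c` then
has rate `0`, so the lower estimate there determines the partition function up to
`exp (o(V))`, and the estimates for Gibbs sums become estimates for probabilities. -/
theorem isGoodLDP_of_profile {c : ℕ+ → ℝ} (hc : ∀ r, 0 < c r) (hcs : Summable c) {T : ℝ}
    (hT : ∀ τ < T, Summable fun r : ℕ+ => c r * Real.exp (r * τ))
    (hcT : Tendsto (fun r : ℕ+ => Real.log (c r) / r) atTop (𝓝 (-T))) {ρ : ℝ} (hρ : 0 < ρ)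
    (hcρ : Summable fun r : ℕ+ => (r : ℝ) * c r) (hcρ' : ∑' r : ℕ+, (r : ℝ) * c r ≤ ρ)
    (hzero : (ρ - ∑' r : ℕ+, (r : ℝ) * c r) * T = 0)
    {V : ℕ → ℝ} (hVpos : ∀ n, 0 < V n) (hV : Tendsto V atTop atTop) {M : ℕ → ℕ}
    (hM : Tendsto (fun n => (M n : ℝ) / V n) atTop (𝓝 ρ)) {I : (ℕ+ → ℝ≥0) → EReal}
    (hI : ∀ ℓ, profileMass ℓ ≤ ENNReal.ofReal ρ → I ℓ = (relEntropy ℓ c : EReal)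
      + (((ρ - ∑' r : ℕ+, (r : ℝ) * (ℓ r : ℝ)) * T : ℝ) : EReal))
    (hI' : ∀ ℓ, ENNReal.ofReal ρ < profileMass ℓ → I ℓ = ⊤) :
    IsGoodLDP (fun n => scaledLaw c (V n) (M n)) V I := by
  set C := ∑' r, c r with hC
  have hZpos : ∀ n, 0 < partitionFunction c (V n) (M n) := fun n =>
    partitionFunction_pos hc (hVpos n) (M n)
  have hZle : ∀ n, partitionFunction c (V n) (M n) ≤ Real.exp (V n * C) := fun n =>
    partitionFunction_le_exp hc hcs (hVpos n) (M n)
  have hZge : ∀ ε, 0 < ε → ∀ᶠ n in atTop,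
      Real.exp (V n * (C - ε)) ≤ partitionFunction c (V n) (M n) := by
    intro ε hε
    have hco : ∀ r, ((Real.toNNReal (c r) : ℝ≥0) : ℝ) = c r := fun r =>
      Real.coe_toNNReal _ (hc r).le
    have h := hasExpLowerBound hc hcs hcT hρ hVpos hV hM (ℓ := fun r => Real.toNNReal (c r))
      (by simpa only [hco] using hcρ) (by simpa only [hco] using hcρ')
      (by rw [relEntropy_self hc]; exact ENNReal.zero_ne_top)
    simp only [hco, relEntropy_self hc, hzero, ENNReal.toReal_zero, sub_zero] at h
    have := h Set.univ isOpen_univ trivial (C - ε) (sub_lt_self _ hε)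
    simpa only [gibbsSum_univ] using this
  have hzeroU : ∀ q : ℝ≥0∞, ENNReal.ofReal ρ < q →
      ∀ᶠ n in atTop, scaledLaw c (V n) (M n) {y | q < profileMass y} = 0 := by
    intro q hq
    filter_upwards [eventually_gibbsSum_eq_zero c hVpos hM hq] with n hn
    rw [scaledLaw_apply hc (hVpos n) _ (isOpen_lt_profileMass q).measurableSet, hn]
    simp
  refine IsGoodLDP.of_local (K := {y | profileMass y ≤ ENNReal.ofReal (ρ + 1)})
    (fun n => isProbabilityMeasure_scaledLaw hc (hVpos n) (M n)) hVpos hV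
    (isCompact_profileMass_le ENNReal.ofReal_ne_top) ?_ ?_ ?_
  · have hcompl : {y | profileMass y ≤ ENNReal.ofReal (ρ + 1)}ᶜ
        = {y | ENNReal.ofReal (ρ + 1) < profileMass y} := by
      ext y; simp
    rw [hcompl]
    exact hzeroU _ ((ENNReal.ofReal_lt_ofReal_iff (by linarith)).2 (by linarith))
  · intro ℓ b hb
    rcases lt_or_ge (ENNReal.ofReal ρ) (profileMass ℓ) with hlt | hle
    · obtain ⟨q, hq1, hq2⟩ := exists_between hlt
      refine ⟨_, isOpen_lt_profileMass q, hq2, ?_⟩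
      filter_upwards [hzeroU q hq1] with n hn
      rw [hn]
      exact zero_le
    · obtain ⟨hs, hx⟩ := hasSum_of_profileMass_le hρ.le hle
      obtain ⟨b', hbb', hb'⟩ := EReal.lt_iff_exists_real_btwn.1 hb
      rw [hI ℓ hle] at hb'
      have hb'' : ((b' - (ρ - ∑' r : ℕ+, (r : ℝ) * (ℓ r : ℝ)) * T : ℝ) : EReal)
          < relEntropy ℓ c := by
        rw [EReal.coe_sub]
        exact EReal.sub_lt_of_lt_add hb'
      obtain ⟨U, hU, hℓU, h⟩ := exists_isOpen_gibbsSum_le hc hcs hT hVpos hM hs hx hb''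
      refine ⟨U, hU, hℓU, ?_⟩
      filter_upwards [h, hZge (b' - b) (sub_pos.2 (EReal.coe_lt_coe_iff.1 hbb'))] with n h1 h2
      rw [scaledLaw_apply hc (hVpos n) _ hU.measurableSet]
      refine ENNReal.ofReal_le_ofReal ?_
      rw [div_le_iff₀ (hZpos n)]
      refine h1.trans (le_trans (le_of_eq ?_)
        (mul_le_mul_of_nonneg_left h2 (Real.exp_pos _).le))
      rw [← Real.exp_add]
      congr 1
      ring
  · intro ℓ b hb G hG hℓG
    have hle : profileMass ℓ ≤ ENNReal.ofReal ρ := by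
      by_contra! hlt
      rw [hI' ℓ hlt] at hb
      exact not_top_lt hb
    obtain ⟨hs, hx⟩ := hasSum_of_profileMass_le hρ.le hle
    rw [hI ℓ hle] at hb
    have hH : relEntropy ℓ c ≠ ∞ := by
      intro h
      rw [h, EReal.coe_ennreal_top, EReal.top_add_coe] at hb
      exact not_top_lt hb
    have hb' : (relEntropy ℓ c).toReal + (ρ - ∑' r : ℕ+, (r : ℝ) * (ℓ r : ℝ)) * T < b := by
      rw [← EReal.coe_ennreal_toReal hH, ← EReal.coe_add] at hb
      exact EReal.coe_lt_coe_iff.1 hb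
    filter_upwards [hasExpLowerBound hc hcs hcT hρ hVpos hV hM hs hx hH G hG hℓG (C - b)
      (by linarith)] with n hn
    rw [scaledLaw_apply hc (hVpos n) _ hG.measurableSet]
    refine ENNReal.ofReal_le_ofReal ?_
    rw [le_div_iff₀ (hZpos n)]
    refine (mul_le_mul_of_nonneg_left (hZle n) (Real.exp_pos _).le).trans
      (le_trans (le_of_eq ?_) hn)
    rw [← Real.exp_add]
    congr 1
    ring

/-! ### The equilibrium profile -/

theorem fugacity_pos {Q : ℕ+ → ℝ} (hQ : ∀ r, 0 < Q r) {φc : ℝ} (hc : 0 < φc)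
    (hφc : Tendsto (fun r : ℕ+ => Q r ^ (-(1 : ℝ) / (r : ℝ))) atTop (𝓝 φc)) {ρ : ℝ}
    (hρ : 0 < ρ) : 0 < fugacity Q φc ρ := by
  obtain ⟨h0, -, h2⟩ := fugacity_spec hQ hc hφc ρ
  refine h0.lt_of_ne fun h => ?_
  rw [← h] at h2
  have hz : massSeries Q 0 = 0 := by simp [massSeries]
  have hpos : 0 < massSeries Q φc := by
    refine lt_of_lt_of_le ?_ (ENNReal.le_tsum (1 : ℕ+))
    have := hQ 1
    simp [this, hc]
  rw [hz] at h2
  exact (lt_min (ENNReal.ofReal_pos.2 hρ) hpos).ne h2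

theorem summable_of_summable_mul {f : ℕ+ → ℝ} (hf : ∀ r, 0 ≤ f r)
    (h : Summable fun r : ℕ+ => (r : ℝ) * f r) : Summable f :=
  h.of_nonneg_of_le hf fun r =>
    le_mul_of_one_le_left (hf r) (by exact_mod_cast r.pos)

/-- The equilibrium profile has mass `ρ`, unless `φ(ρ) = φ_c`. -/
theorem profile_mass {Q : ℕ+ → ℝ} (hQ : ∀ r, 0 < Q r) {φc : ℝ} (hc : 0 < φc)
    (hφc : Tendsto (fun r : ℕ+ => Q r ^ (-(1 : ℝ) / (r : ℝ))) atTop (𝓝 φc)) {ρ : ℝ}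
    (hρ : 0 < ρ) :
    (Summable fun r : ℕ+ => (r : ℝ) * profile Q φc ρ r) ∧
      ∑' r : ℕ+, (r : ℝ) * profile Q φc ρ r ≤ ρ ∧
      (∑' r : ℕ+, (r : ℝ) * profile Q φc ρ r = ρ ∨ fugacity Q φc ρ = φc) := by
  obtain ⟨h0, -, h2⟩ := fugacity_spec hQ hc hφc ρ
  have hnn : ∀ r : ℕ+, 0 ≤ (r : ℝ) * profile Q φc ρ r := fun r => by
    have := (hQ r).le
    unfold profile
    positivity
  have heq : massSeries Q (fugacity Q φc ρ)
      = ∑' r : ℕ+, ENNReal.ofReal ((r : ℝ) * profile Q φc ρ r) := by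
    simp only [massSeries, profile, mul_assoc]
  have hle : massSeries Q (fugacity Q φc ρ) ≤ ENNReal.ofReal ρ := h2 ▸ min_le_left _ _
  have hs : Summable fun r : ℕ+ => (r : ℝ) * profile Q φc ρ r := by
    have := ENNReal.summable_toReal (heq ▸ ne_top_of_le_ne_top ENNReal.ofReal_ne_top hle)
    simpa only [ENNReal.toReal_ofReal (hnn _)] using this
  rw [← ENNReal.ofReal_tsum_of_nonneg hnn hs] at heq
  refine ⟨hs, ?_, ?_⟩
  · rwa [heq, ENNReal.ofReal_le_ofReal_iff hρ.le] at hle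
  · rcases le_total (ENNReal.ofReal ρ) (massSeries Q φc) with h | h
    · left
      rw [min_eq_left h, heq] at h2
      exact (ENNReal.ofReal_eq_ofReal_iff (tsum_nonneg hnn) hρ.le).1 h2
    · exact Or.inr (fugacity_unique hQ hc hφc ρ hc.le (min_eq_right h).symm).symm

theorem tendsto_log_div {Q : ℕ+ → ℝ} (hQ : ∀ r, 0 < Q r) {φc : ℝ} (hc : 0 < φc)
    (hφc : Tendsto (fun r : ℕ+ => Q r ^ (-(1 : ℝ) / (r : ℝ))) atTop (𝓝 φc)) :
    Tendsto (fun r : ℕ+ => Real.log (Q r) / r) atTop (𝓝 (-Real.log φc)) := by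
  refine ((Real.continuousAt_log hc.ne').tendsto.comp hφc).neg.congr fun r => ?_
  simp only [Function.comp_apply]
  rw [Real.log_rpow (hQ r)]
  ring

end ClusterLDP

theorem mainTheorem1 (Q : ℕ+ → ℝ) (hQ : ∀ r, 0 < Q r) (φc : ℝ) (hφc_gt : 1 < φc)
    (hφc : Tendsto (fun r : ℕ+ => Q r ^ (-(1 : ℝ) / (r : ℝ))) atTop (𝓝 φc))
    (ρ : ℝ) (hρ : 0 < ρ) (V : ℕ → ℝ) (hVpos : ∀ n, 0 < V n) (hV : Tendsto V atTop atTop)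
    (M : ℕ → ℕ) (hM : Tendsto (fun n => (M n : ℝ) / V n) atTop (𝓝 ρ)) :
    ClusterLDP.IsGoodLDP (fun n => ClusterLDP.scaledLaw Q (V n) (M n)) V
      (ClusterLDP.rate Q φc ρ) := by
  open ClusterLDP in
  have hc0 : 0 < φc := one_pos.trans hφc_gt
  have hf0 := fugacity_pos hQ hc0 hφc hρ
  obtain ⟨hs, hle, hor⟩ := profile_mass hQ hc0 hφc hρ
  have hpos : ∀ r, 0 < profile Q φc ρ r := fun r => mul_pos (hQ r) (pow_pos hf0 _)
  have hpow : ∀ r : ℕ+, fugacity Q φc ρ ^ (r : ℕ)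
      = Real.exp (r * Real.log (fugacity Q φc ρ)) := fun r => by
    rw [Real.exp_nat_mul, Real.exp_log hf0]
  have hprof : profile Q φc ρ
      = fun r : ℕ+ => Q r * Real.exp (r * Real.log (fugacity Q φc ρ)) := by
    ext r
    rw [profile, hpow]
  have hlaw : (fun n => scaledLaw Q (V n) (M n))
      = fun n => scaledLaw (profile Q φc ρ) (V n) (M n) := by
    ext1 n
    rw [hprof, scaledLaw_geometric_tilt]
  rw [hlaw]
  refine isGoodLDP_of_profile (T := -Real.log (fugacity Q φc ρ / φc)) hpos
    (summable_of_summable_mul (fun r => (hpos r).le) hs) ?_ ?_ hρ hs hle ?_ hVpos hV hM ?_ ?_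
  · intro τ hτ
    have hz : fugacity Q φc ρ * Real.exp τ < φc := by
      have h := Real.exp_lt_exp.2 hτ
      rw [Real.exp_neg, Real.exp_log (div_pos hf0 hc0), inv_div, lt_div_iff₀ hf0] at h
      linarith
    have hz0 : 0 ≤ fugacity Q φc ρ * Real.exp τ := by positivity
    have h := summable_of_summable_mul
      (f := fun r => Q r * (fugacity Q φc ρ * Real.exp τ) ^ (r : ℕ))
      (fun r => mul_nonneg (hQ r).le (pow_nonneg hz0 _))
      (by simpa only [mul_assoc] using summable_mass hQ hφc hz0 hz)
    refine h.congr fun r => ?_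
    rw [profile, mul_pow, Real.exp_nat_mul, mul_assoc]
  · have h := (tendsto_log_div hQ hc0 hφc).add_const (Real.log (fugacity Q φc ρ))
    rw [Real.log_div hf0.ne' hc0.ne', neg_neg, sub_eq_neg_add]
    refine h.congr fun r => ?_
    have hr : (r : ℝ) ≠ 0 := by exact_mod_cast r.ne_zero
    rw [profile, Real.log_mul (hQ r).ne' (pow_pos hf0 _).ne', Real.log_pow]
    field_simp
  · rcases hor with h | h
    · rw [h, sub_self, zero_mul]
    · rw [h, div_self hc0.ne', Real.log_one, neg_zero, mul_zero]
  · intro ℓ hℓ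
    rw [rate, ← profileMass, if_pos hℓ, sub_eq_add_neg, ← EReal.coe_neg, mul_neg]
  · intro ℓ hℓ
    rw [rate, ← profileMass, if_neg (not_le.2 hℓ)]
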